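/- All monoids are commutative and written additively. Let $I$ be a nonempty lower semilattice (a partially ordered set in which any two elements have an infimum), and let $\mathbb{M}=((M_i)_{i\in I},(p_{ij}\colon M_j\to M_i)_{i\le j})$ be a projective system of monoids over $I$. Assume: - $\mathbb{M}$ is *openly immersive*: for all $i\le j$ the morphism $\operatorname{Spec}(\mathbb{Z}[p_{ij}])\colon \operatorname{Spec}(\mathbb{Z}[M_i])\to\operatorname{Spec}(\mathbb{Z}[M_j])$ is an open immersion; - $\mathbb{M}$ is *cancellable*: in every $M_i$, $m+k=m+l$ implies $k=l$; - $\mathbb{M}$ is *torsionfree*: in every $M_i$, $rm=rn$ with $r\ge 1$ an integer implies $m=n$. Let $X_{\mathbb{M}}(\mathbb{Z})$ be the inductive limit in the category of schemes of the schemes $\operatorname{Spec}(\mathbb{Z}[M_i])$ along these open immersions. For a scheme $S$ put $X_{\mathbb{M}}(S)=X_{\mathbb{M}}(\mathbb{Z})\times S$ (product of schemes), and let $t_{\mathbb{M}}(S)\colon X_{\mathbb{M}}(S)\to S$ be the projection. For a closed subset $Z$ of $S$, regarded as a reduced closed subscheme, identify $X_{\mathbb{M}}(Z)$ with its image in $X_{\mathbb{M}}(S)$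 under the morphism induced by $Z\hookrightarrow S$. Let $S$ be a scheme. a) The maps $Z\mapsto X_{\mathbb{M}}(Z)$ and $Z\mapsto t_{\mathbb{M}}(S)(Z)$ induce mutually inverse bijections between the set of irreducible components of $S$ and the set of irreducible components of $X_{\mathbb{M}}(S)$. b) If $I$ is finite, or every $M_i$ is finitely generated, or $S$ is affine and $I$ has a smallest element, then the maps $Z\mapsto X_{\mathbb{M}}(Z)$ and $Z\mapsto t_{\mathbb{M}}(S)(Z)$ induce mutually inverse bijections between the set of connected components of $S$ and the set of connected components of $X_{\mathbb{M}}(S)$. -/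

import Mathlib

open CategoryTheory CategoryTheory.Limits AlgebraicGeometry

universe u

namespace MonoidGluing

noncomputable section

/-! ### Diagrams of spectra of algebras of monoids -/

/-- The functor `M ↦ R[M]` of algebras of (commutative, additively written) monoids over `R`. -/
def algebraFunctor (R : CommRingCat.{u}) : AddCommMonCat.{u} ⥤ CommRingCat.{u} where
  obj M := CommRingCat.of (AddMonoidAlgebra R M)
  map f := CommRingCat.ofHom (AddMonoidAlgebra.mapDomainRingHom R f.hom)
  map_id M := by
    ext x
    all_goals simp
  map_comp f g := by
    ext x
    all_goals simp

section System

variable {I : Type u} [SemilatticeInf I] (𝕄 : Iᵒᵖ ⥤ AddCommMonCat.{u})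

/-- A projective system of monoids over `I` is a functor `𝕄 : Iᵒᵖ ⥤ AddCommMonCat`, so that
`i ≤ j` gives `M_j → M_i`. It yields the inductive system of the schemes `Spec R[M_i]`. -/
def specDiagram (R : CommRingCat.{u}) : I ⥤ Scheme.{u} :=
  (𝕄 ⋙ algebraFunctor R).rightOp ⋙ Scheme.Spec

/-- The diagram of the schemes `Spec ℤ[M_i]`. -/
abbrev specIntDiagram : I ⥤ Scheme.{u} := specDiagram 𝕄 (CommRingCat.of (ULift.{u} ℤ))

/-- The system is openly immersive if `Spec ℤ[M_i] ⟶ Spec ℤ[M_j]` is an open immersion for all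
`i ≤ j`. -/
class OpenlyImmersive : Prop where
  isOpenImmersion : ∀ {i j : I} (f : i ⟶ j), IsOpenImmersion ((specIntDiagram 𝕄).map f)

attribute [instance] OpenlyImmersive.isOpenImmersion

end System

/-! ### Existence of the inductive limit

A diagram of open immersions between integral separated schemes over a nonempty lower semilattice
has a colimit, into which the members of the diagram embed as open subschemes. -/

theorem uniqueSums_of_fg {M : Type u} [i : AddCommMonoid M] [IsCancelAdd M] [h : IsAddTorsionFree M]
    [hf : AddMonoid.FG M] : UniqueSums M :=
  let c : AddCancelCommMonoid M := { i with add_left_cancel := fun _ _ _ h => add_left_cancel h }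
  (@AffineAddMonoid.to_twoUniqueSums M c hf h).toUniqueSums

/-- Torsionfree cancellable commutative monoids have unique sums. -/
theorem uniqueSums {M : Type u} [AddCommMonoid M] [IsCancelAdd M] [IsAddTorsionFree M] :
    UniqueSums M where
  uniqueAdd_of_nonempty {A B} hA hB := by
    classical
    let N : AddSubmonoid M := AddSubmonoid.closure (A ∪ B : Finset M)
    have : AddMonoid.FG N := (AddMonoid.fg_iff_addSubmonoid_fg N).mpr ⟨A ∪ B, rfl⟩
    have : IsAddTorsionFree N := Subtype.val_injective.isAddTorsionFree N.subtype
    have hAN : ∀ a ∈ A, a ∈ N := fun a ha => AddSubmonoid.subset_closure (by simp [ha])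
    have hBN : ∀ b ∈ B, b ∈ N := fun b hb => AddSubmonoid.subset_closure (by simp [hb])
    let A' : Finset N := A.attach.image fun a => ⟨a.1, hAN _ a.2⟩
    let B' : Finset N := B.attach.image fun b => ⟨b.1, hBN _ b.2⟩
    have : IsCancelAdd N := Subtype.val_injective.isCancelAdd _ fun _ _ => rfl
    have : UniqueSums N := uniqueSums_of_fg
    obtain ⟨a, ha, b, hb, hab⟩ := UniqueSums.uniqueAdd_of_nonempty (A := A') (B := B')
      (by simpa [A'] using hA) (by simpa [B'] using hB)
    refine ⟨a.1, ?_, b.1, ?_, ?_⟩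
    · obtain ⟨x, -, rfl⟩ := Finset.mem_image.mp ha
      exact x.2
    · obtain ⟨x, -, rfl⟩ := Finset.mem_image.mp hb
      exact x.2
    · intro x y hx hy hxy
      have := @hab ⟨x, hAN x hx⟩ ⟨y, hBN y hy⟩ (Finset.mem_image.mpr ⟨⟨x, hx⟩, by simp⟩)
        (Finset.mem_image.mpr ⟨⟨y, hy⟩, by simp⟩) (Subtype.ext hxy)
      exact ⟨congrArg Subtype.val this.1, congrArg Subtype.val this.2⟩

section Colimit

variable {I : Type u} [SemilatticeInf I] (F : I ⥤ Scheme.{u}) {Y : Scheme.{u}}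
  (γ : ∀ i, Y ⟶ F.obj i)

/-- An open subscheme of a member of the diagram through which the given morphism factors. -/
structure Chart where
  idx : I
  U : (F.obj idx).Opens
  b : Y ⟶ U
  hb : b ≫ U.ι = γ idx

/-- Morphisms of charts: open immersions compatible with the given morphisms and with every
cocone under the diagram. -/
@[ext]
structure Chart.Hom (P Q : Chart F γ) where
  f : (P.U : Scheme.{u}) ⟶ Q.U
  isOpen : IsOpenImmersion f
  hf : P.b ≫ f = Q.b
  hs : ∀ s : Cocone F, P.U.ι ≫ s.ι.app P.idx = f ≫ Q.U.ι ≫ s.ι.app Q.idx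

instance : Category (Chart F γ) where
  Hom P Q := Chart.Hom F γ P Q
  id P := ⟨𝟙 _, inferInstance, by simp, by simp⟩
  comp {P Q R} f g := ⟨f.f ≫ g.f, by have := f.isOpen; have := g.isOpen; infer_instance,
    by rw [← Category.assoc, f.hf, g.hf], fun s => by rw [f.hs, g.hs, Category.assoc]⟩
  id_comp _ := Chart.Hom.ext (Category.id_comp _)
  comp_id _ := Chart.Hom.ext (Category.comp_id _)
  assoc _ _ _ := Chart.Hom.ext (Category.assoc _ _ _)

/-- The functor sending a chart to its underlying scheme. -/
def chartFunctor : Chart F γ ⥤ Scheme.{u} where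
  obj P := P.U
  map f := f.f
  map_id _ := rfl
  map_comp _ _ := rfl

instance {P Q : Chart F γ} (f : P ⟶ Q) : IsOpenImmersion ((chartFunctor F γ).map f) := f.isOpen

instance : ((chartFunctor F γ) ⋙ Scheme.forget).IsLocallyDirected where
  cond {P Q R} f g x y hxy := by
    have := f.isOpen
    have := g.isOpen
    have hxy' : f.f x = g.f y := hxy
    obtain ⟨z, hz1, hz2⟩ := Scheme.Pullback.exists_preimage_pullback (f := f.f) (g := g.f) x y hxy'
    let p := pullback.fst f.f g.f
    let q := pullback.snd f.f g.f
    have hpq : p ≫ f.f = q ≫ g.f := pullback.condition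
    let e := (p ≫ P.U.ι).isoOpensRange
    have he : e.inv ≫ p ≫ P.U.ι = (p ≫ P.U.ι).opensRange.ι := by simp [e]
    let d : Y ⟶ pullback f.f g.f := pullback.lift P.b Q.b (by rw [f.hf, g.hf])
    have hdp : d ≫ p = P.b := pullback.lift_fst _ _ _
    have hdq : d ≫ q = Q.b := pullback.lift_snd _ _ _
    let L : Chart F γ := ⟨P.idx, (p ≫ P.U.ι).opensRange, d ≫ e.hom, by
      rw [← he]; simp only [Category.assoc, Iso.hom_inv_id_assoc]
      rw [reassoc_of% hdp, P.hb]⟩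
    refine ⟨L, ⟨e.inv ≫ p, inferInstance, by simp [L, hdp], fun s => ?_⟩,
      ⟨e.inv ≫ q, inferInstance, by simp [L, hdq], fun s => ?_⟩, e.hom z, ?_, ?_⟩
    · dsimp only [L]; rw [← he]; simp only [Category.assoc]
    · dsimp only [L]; rw [← he]; simp only [Category.assoc]
      rw [f.hs, reassoc_of% hpq, ← g.hs]
    · change (e.inv ≫ p) (e.hom z) = x
      rw [← hz1]
      simp [p, ← Scheme.Hom.comp_apply]
    · change (e.inv ≫ q) (e.hom z) = y
      rw [← hz2]
      simp [q, ← Scheme.Hom.comp_apply]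

theorem chart_isThin [∀ i, IsIntegral (F.obj i)] [∀ i, (F.obj i).IsSeparated]
    [∀ i, IsDominant (γ i)] : Quiver.IsThin (Chart F γ) := fun P Q => ⟨fun f g => by
  apply Chart.Hom.ext
  have hP : IsDominant (P.b ≫ P.U.ι) := by rw [P.hb]; infer_instance
  have : IsDominant P.b := .of_comp_of_isOpenImmersion P.b P.U.ι
  rw [← cancel_mono Q.U.ι]
  apply ext_of_isDominant P.b
  rw [← Category.assoc, ← Category.assoc, f.hf, g.hf]⟩

/-- The chart given by a whole member of the diagram. -/
def topChart (i : I) : Chart F γ := ⟨i, ⊤, γ i ≫ (F.obj i).topIso.inv, by simp⟩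

/-- The inclusion of a chart into the member of the diagram containing it. -/
def Chart.incl (P : Chart F γ) : (chartFunctor F γ).obj P ⟶ F.obj P.idx := P.U.ι

/-- The identification of a member of the diagram with its chart. -/
def inclTop (i : I) : F.obj i ⟶ (chartFunctor F γ).obj (topChart F γ i) := (F.obj i).topIso.inv

instance (i : I) : IsIso (inclTop F γ i) :=
  inferInstanceAs (IsIso (F.obj i).topIso.inv)

theorem inclTop_incl (i : I) : inclTop F γ i ≫ (topChart F γ i).incl = 𝟙 (F.obj i) :=
  (F.obj i).topIso.inv_hom_id

/-- The inclusion of a chart into the chart of the whole member, as a morphism of charts. -/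
def toTop (P : Chart F γ) : P ⟶ topChart F γ P.idx :=
  ⟨P.U.ι ≫ (F.obj P.idx).topIso.inv,
    inferInstanceAs (IsOpenImmersion (P.U.ι ≫ (F.obj P.idx).topIso.inv)),
    by simp [topChart, reassoc_of% P.hb], fun s => by simp [topChart]⟩

theorem map_toTop (P : Chart F γ) :
    (chartFunctor F γ).map (toTop F γ P) = P.incl ≫ inclTop F γ P.idx := rfl

/-- A cocone under the diagram restricts to a cocone under the diagram of charts. -/
def chartCocone (s : Cocone F) : Cocone (chartFunctor F γ) where
  pt := s.pt
  ι :=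
    { app P := P.incl ≫ s.ι.app P.idx
      naturality _ _ f := (f.hs s).symm.trans (Category.comp_id _).symm }

theorem chartCocone_app (s : Cocone F) (P : Chart F γ) :
    (chartCocone F γ s).ι.app P = P.incl ≫ s.ι.app P.idx := rfl

/-- The morphisms into the colimit of the charts. -/
def colimι [HasColimit (chartFunctor F γ)] (i : I) : F.obj i ⟶ colimit (chartFunctor F γ) :=
  inclTop F γ i ≫ colimit.ι (chartFunctor F γ) (topChart F γ i)

theorem colimι_desc [HasColimit (chartFunctor F γ)] (s : Cocone F) (i : I) :
    colimι F γ i ≫ colimit.desc (chartFunctor F γ) (chartCocone F γ s) = s.ι.app i := by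
  rw [colimι, Category.assoc]
  refine (inclTop F γ i ≫= colimit.ι_desc _ _).trans ?_
  rw [chartCocone_app]
  exact (Category.assoc _ _ _).symm.trans ((inclTop_incl F γ i =≫ _).trans (Category.id_comp _))

theorem incl_colimι [HasColimit (chartFunctor F γ)] (P : Chart F γ) :
    P.incl ≫ colimι F γ P.idx = colimit.ι (chartFunctor F γ) P := by
  rw [colimι, ← Category.assoc, ← map_toTop, colimit.w]

variable [∀ {i j} (f : i ⟶ j), IsOpenImmersion (F.map f)]

variable (hγ : ∀ {i j} (f : i ⟶ j), γ i ≫ F.map f = γ j)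

/-- The morphism of charts given by a transition morphism of the diagram. -/
def topChartMap {i j : I} (f : i ⟶ j) : topChart F γ i ⟶ topChart F γ j :=
  ⟨(F.obj i).topIso.hom ≫ F.map f ≫ (F.obj j).topIso.inv,
    inferInstanceAs (IsOpenImmersion ((F.obj i).topIso.hom ≫ F.map f ≫ (F.obj j).topIso.inv)),
    by simp [topChart, reassoc_of% (hγ f)], fun s => by simp [topChart]⟩

theorem inclTop_map {i j : I} (f : i ⟶ j) :
    inclTop F γ i ≫ (chartFunctor F γ).map (topChartMap F γ hγ f) = F.map f ≫ inclTop F γ j :=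
  (F.obj i).topIso.inv_hom_id_assoc _

/-- The colimit of the charts as a cocone under the original diagram. -/
def cocone [HasColimit (chartFunctor F γ)] : Cocone F where
  pt := colimit (chartFunctor F γ)
  ι :=
    { app i := colimι F γ i
      naturality i j f := by
        refine Eq.trans ?_ (Category.comp_id _).symm
        rw [colimι, colimι, ← Category.assoc, ← inclTop_map F γ hγ, Category.assoc, colimit.w] }

/-- The colimit of the charts is the colimit of the original diagram. -/
def isColimit [HasColimit (chartFunctor F γ)] : IsColimit (cocone F γ hγ) where
  desc s := colimit.desc (chartFunctor F γ) (chartCocone F γ s)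
  fac s i := colimι_desc F γ s i
  uniq s m hm := by
    refine colimit.hom_ext (F := chartFunctor F γ) (f := m) fun P => ?_
    refine Eq.trans ?_ (colimit.ι_desc (chartCocone F γ s) P).symm
    rw [← incl_colimι]
    exact (Category.assoc _ _ _).trans (P.incl ≫= hm P.idx)

variable [∀ i, IsIntegral (F.obj i)]

theorem exists_generic (i₀ : I) : ∃ (Y : Scheme.{u}) (γ : ∀ i, Y ⟶ F.obj i),
    (∀ i, IsDominant (γ i)) ∧ ∀ {i j} (f : i ⟶ j), γ i ≫ F.map f = γ j := by
  let ξ := genericPoint (F.obj i₀)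
  let y := (F.obj i₀).fromSpecResidueField ξ
  have hr (i : I) : Set.range y ⊆ Set.range (F.map (homOfLE (inf_le_left : i₀ ⊓ i ≤ i₀))) := by
    rw [Scheme.range_fromSpecResidueField, Set.singleton_subset_iff]
    exact ((genericPoint_spec _).mem_open_set_iff (F.map (homOfLE (inf_le_left : i₀ ⊓ i ≤ i₀))).opensRange.2).mpr
      ⟨_, trivial, Set.mem_range_self (Classical.arbitrary _)⟩
  let y' (i : I) := IsOpenImmersion.lift (F.map (homOfLE (inf_le_left : i₀ ⊓ i ≤ i₀))) y (hr i)
  have hy' (i : I) : y' i ≫ F.map (homOfLE (inf_le_left : i₀ ⊓ i ≤ i₀)) = y :=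
    IsOpenImmersion.lift_fac _ _ _
  have hy : IsDominant y := ⟨by
    rw [DenseRange, Scheme.range_fromSpecResidueField]
    exact dense_iff_closure_eq.mpr (genericPoint_closure _)⟩
  refine ⟨_, fun i => y' i ≫ F.map (homOfLE inf_le_right), fun i => ?_, fun {i j} f => ?_⟩
  · have : IsDominant (y' i ≫ F.map (homOfLE (inf_le_left : i₀ ⊓ i ≤ i₀))) := by
      rw [hy']; exact hy
    have : IsDominant (y' i) := .of_comp_of_isOpenImmersion _
      (F.map (homOfLE (inf_le_left : i₀ ⊓ i ≤ i₀)))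
    have : IsDominant (F.map (homOfLE (inf_le_right : i₀ ⊓ i ≤ i))) :=
      ⟨(F.map (homOfLE (inf_le_right : i₀ ⊓ i ≤ i))).opensRange.2.dense
        ⟨_, Set.mem_range_self (Classical.arbitrary _)⟩⟩
    infer_instance
  · have h : y' i ≫ F.map (homOfLE (inf_le_inf_left i₀ f.le)) = y' j := by
      rw [← cancel_mono (F.map (homOfLE (inf_le_left : i₀ ⊓ j ≤ i₀))), hy', Category.assoc,
        ← F.map_comp, ← hy' i]
      rfl
    dsimp only
    rw [← h, Category.assoc, Category.assoc, ← F.map_comp, ← F.map_comp]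
    rfl

variable [Nonempty I] [∀ i, (F.obj i).IsSeparated]

theorem exists_colimit : ∃ c : Cocone F, Nonempty (IsColimit c) ∧
    ∀ i, IsOpenImmersion (c.ι.app i) := by
  obtain ⟨Y, γ, _, hγ⟩ := exists_generic F (Classical.arbitrary I)
  have := chart_isThin F γ
  exact ⟨cocone F γ hγ, ⟨isColimit F γ hγ⟩, fun i => 
    inferInstanceAs (IsOpenImmersion
      (inclTop F γ i ≫ colimit.ι (chartFunctor F γ) (topChart F γ i)))⟩

theorem hasColimit_of_integral : HasColimit F := by
  obtain ⟨c, ⟨hc⟩, -⟩ := exists_colimit F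
  exact ⟨c, hc⟩

theorem isOpenImmersion_colimit_ι [HasColimit F] (i : I) : IsOpenImmersion (colimit.ι F i) := by
  obtain ⟨c, ⟨hc⟩, h⟩ := exists_colimit F
  have := h i
  have e := IsColimit.comp_coconePointUniqueUpToIso_hom hc (colimit.isColimit F) i
  rw [colimit.cocone_ι] at e
  rw [← e]
  infer_instance

end Colimit

/-! ### The functor `X_𝕄` -/

section Construction

variable {I : Type u} [SemilatticeInf I] (𝕄 : Iᵒᵖ ⥤ AddCommMonCat.{u})

section Existence

variable [∀ i, IsCancelAdd (𝕄.obj i)] [∀ i, IsAddTorsionFree (𝕄.obj i)]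

instance isIntegral_specIntDiagram (i : I) : IsIntegral ((specIntDiagram 𝕄).obj i) := by
  have : IsDomain (ULift.{u} ℤ) := (ULift.ringEquiv (R := ℤ)).toMulEquiv.isDomain ℤ
  have := uniqueSums (M := 𝕄.obj (Opposite.op i))
  exact inferInstanceAs (IsIntegral (Spec (CommRingCat.of
    (AddMonoidAlgebra (ULift.{u} ℤ) (𝕄.obj (Opposite.op i))))))

instance isSeparated_specIntDiagram (i : I) : ((specIntDiagram 𝕄).obj i).IsSeparated :=
  inferInstanceAs (Spec (CommRingCat.of
    (AddMonoidAlgebra (ULift.{u} ℤ) (𝕄.obj (Opposite.op i))))).IsSeparated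

instance hasColimit_specIntDiagram [Nonempty I] [OpenlyImmersive 𝕄] :
    HasColimit (specIntDiagram 𝕄) :=
  hasColimit_of_integral _

instance isOpenImmersion_ι_specIntDiagram [Nonempty I] [OpenlyImmersive 𝕄] (i : I) :
    IsOpenImmersion (colimit.ι (specIntDiagram 𝕄) i) :=
  isOpenImmersion_colimit_ι _ i

end Existence

variable [HasColimit (specIntDiagram 𝕄)]

/-- `X_𝕄(ℤ)`, the inductive limit of the schemes `Spec ℤ[M_i]`. -/
abbrev XInt : Scheme.{u} := colimit (specIntDiagram 𝕄)

/-- `X_𝕄(S) = X_𝕄(ℤ) × S`, the product of schemes being the fibre product over the terminal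
scheme. -/
abbrev X (S : Scheme.{u}) : Scheme.{u} := pullback (terminal.from (XInt 𝕄)) (terminal.from S)

/-- The structural morphism `t_𝕄(S) : X_𝕄(S) ⟶ S`. -/
abbrev t (S : Scheme.{u}) : X 𝕄 S ⟶ S := pullback.snd _ _

/-- The morphism `X_𝕄(f) : X_𝕄(S) ⟶ X_𝕄(S')` induced by `f : S ⟶ S'`. -/
abbrev XMap {S S' : Scheme.{u}} (f : S ⟶ S') : X 𝕄 S ⟶ X 𝕄 S' :=
  pullback.map _ _ _ _ (𝟙 (XInt 𝕄)) f (𝟙 _) (by simp) (by simp)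

/-- The immersion into `S` of the reduced closed subscheme whose underlying set is the closure of
`Z`, hence is `Z` itself if `Z` is closed. -/
def closedImmersion {S : Scheme.{u}} (Z : Set S) :
    (Scheme.IdealSheafData.vanishingIdeal (X := S) ⟨closure Z, isClosed_closure⟩).subscheme ⟶ S :=
  Scheme.IdealSheafData.subschemeι _

/-- The subset `X_𝕄(Z)` of `X_𝕄(S)` for a closed subset `Z` of `S` (such as a component): the
image of `X_𝕄` applied to the immersion of `Z`. -/
def XSet {S : Scheme.{u}} (Z : Set S) : Set (X 𝕄 S) := Set.range (XMap 𝕄 (closedImmersion Z))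

end Construction

end

/-- The set of connected components of a topological space. -/
def connectedComponentSets (T : Type u) [TopologicalSpace T] : Set (Set T) :=
  Set.range (connectedComponent (α := T))

end MonoidGluing

/-!
The theorem holds because `t : X_𝕄(S) ⟶ S` is an open surjective morphism with irreducible fibres,
and because `X_𝕄(Z)` is the preimage of `Z` under `t` for a closed subset `Z` of `S`
(`XSet_eq_preimage`). Along such a morphism the preimage of an irreducible set is irreducible, and
the preimage of a closed connected set is connected, so that taking preimages and images gives
inverse bijections between the irreducible components, and between the connected components, of
source and target.

Both properties of `t` are checked for `X_𝕄(ℤ) ⟶ Spec ℤ` in their universal form, as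
`UniversallyOpen` and `GeometricallyIrreducible`, which are stable under base change. They come from
the following facts about a torsionfree cancellable monoid `M`, for which `K[M]` is a domain whenever
`K` is a field.

* The morphism `Spec A[M] ⟶ Spec A` is open for every ring `A`. A prime `𝔭` lies in the image of
  `D(f)` if and only if `f` is not nilpotent in `κ(𝔭)[M]`, that is, if and only if some coefficient
  of `f` is not in `𝔭`; hence the image of `D(f)` is open
  (`isOpenMap_comap_algebraMap_addMonoidAlgebra`).
* The scheme `Spec K[M]` is irreducible for every field `K`.

The scheme `X_𝕄(ℤ)` is covered by the open subschemes `Spec ℤ[M_i]`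
(`exists_mem_range_colimit_ι`). Universal openness is local on the source. Over a field `K`, the
irreducible open subschemes `Spec K[M_i]` and `Spec K[M_j]` both contain the nonempty
`Spec K[M_{i ∧ j}]`, and a space covered by irreducible open subsets any two of which meet is
irreducible (`geometricallyIrreducible_of_cover`).
-/

namespace MonoidGluing

/-! ### Spectra of algebras of monoids over the base -/

section MonoidAlgebra

open PrimeSpectrum TensorProduct
open scoped AlgebraMonoidAlgebra

variable {R : Type u} [CommRing R] {M : Type u} [AddCommMonoid M]

/-- Since `κ(𝔭)[M]` is reduced, a prime `𝔭` is in the image of `D(f)` if and only if the image of `f`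
in `κ(𝔭)[M]` does not vanish. -/
theorem mem_image_comap_basicOpen_addMonoidAlgebra [UniqueSums M] (f : AddMonoidAlgebra R M)
    (x : PrimeSpectrum R) :
    x ∈ comap (algebraMap R (AddMonoidAlgebra R M)) '' basicOpen f ↔
      ∃ m, f.coeff m ∉ x.asIdeal := by
  trans AddMonoidAlgebra.mapRingHom M (algebraMap R x.asIdeal.ResidueField) f ≠ 0
  · refine (mem_image_comap_basicOpen _ _).trans (not_iff_not.mpr ?_)
    let e : x.asIdeal.ResidueField ⊗[R] AddMonoidAlgebra R M ≃ₐ[x.asIdeal.ResidueField]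
        AddMonoidAlgebra x.asIdeal.ResidueField M := AddMonoidAlgebra.scalarTensorEquiv ..
    rw [← IsNilpotent.map_iff (Algebra.TensorProduct.comm ..).injective,
      ← IsNilpotent.map_iff e.injective, isNilpotent_iff_eq_zero]
    simp [e]
    rfl
  · simp [AddMonoidAlgebra.ext_iff, Finsupp.ext_iff]

/-- The image of `D(f)` in `Spec R` is the complement of the zero locus of the coefficients of
`f`. -/
theorem isOpenMap_comap_algebraMap_addMonoidAlgebra [UniqueSums M] :
    IsOpenMap (comap (algebraMap R (AddMonoidAlgebra R M))) := by
  refine isTopologicalBasis_basic_opens.isOpenMap_iff.mpr ?_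
  rintro _ ⟨f, rfl⟩
  have : comap (algebraMap R (AddMonoidAlgebra R M)) '' basicOpen f =
      (zeroLocus (Set.range f.coeff))ᶜ := by
    ext x
    rw [mem_image_comap_basicOpen_addMonoidAlgebra]
    simp [Set.range_subset_iff]
  rw [this]
  exact (isClosed_zeroLocus _).isOpen_compl

variable (R M) in
/-- The structural morphism `Spec R[M] ⟶ Spec R`. -/
noncomputable abbrev specAlgebraMap :
    Spec (CommRingCat.of (AddMonoidAlgebra R M)) ⟶ Spec (CommRingCat.of R) :=
  Spec.map (CommRingCat.ofHom (algebraMap R (AddMonoidAlgebra R M)))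

theorem isPullback_specAlgebraMap (A : Type u) [CommRing A] [Algebra R A] :
    IsPullback (Spec.map (CommRingCat.ofHom (algebraMap (AddMonoidAlgebra R M)
        (AddMonoidAlgebra A M))))
      (specAlgebraMap A M) (specAlgebraMap R M)
      (Spec.map (CommRingCat.ofHom (algebraMap R A))) := by
  refine isPullback_SpecMap_of_isPushout _ _ _ _ ?_
  have := CommRingCat.isPushout_of_isPushout R A (AddMonoidAlgebra R M) (AddMonoidAlgebra A M)
  exact this.flip

instance geometricallyIrreducible_specAlgebraMap [UniqueSums M] :
    GeometricallyIrreducible (specAlgebraMap R M) := by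
  rw [geometricallyIrreducible_iff, geometrically_iff_of_commRing]
  intro K _ _ Y fst snd h
  exact ObjectProperty.prop_of_iso (fun X : Scheme.{u} => IrreducibleSpace X)
    (h.isoIsPullback _ _ (isPullback_specAlgebraMap K)).symm
    (inferInstanceAs (IrreducibleSpace (Spec (CommRingCat.of (AddMonoidAlgebra K M)))))

instance universallyOpen_specAlgebraMap [UniqueSums M] : UniversallyOpen (specAlgebraMap R M) := by
  refine ⟨fun {X Y} fst y snd h => ?_⟩
  -- Openness of a base change is local on the target, which may be supposed affine.
  wlog hY : ∃ A, Y = Spec A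
  · rw [IsZariskiLocalAtTarget.iff_of_openCover (P := topologically @IsOpenMap) Y.affineCover]
    exact fun i => this _ _ _
      ((IsPullback.of_hasPullback snd (Y.affineCover.f i)).paste_horiz h.flip).flip ⟨_, rfl⟩
  obtain ⟨A, rfl⟩ := hY
  obtain ⟨φ, rfl⟩ := Spec.map_surjective y
  algebraize [φ.hom]
  rw [← h.flip.isoIsPullback_hom_snd _ _ (isPullback_specAlgebraMap A),
    MorphismProperty.cancel_left_of_respectsIso (P := topologically @IsOpenMap)]
  exact isOpenMap_comap_algebraMap_addMonoidAlgebra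

end MonoidAlgebra

/-! ### Geometric irreducibility of a scheme covered by overlapping open subschemes -/

theorem irreducibleSpace_of_cover {T ι : Type*} [TopologicalSpace T] [Nonempty ι] (V : ι → Set T)
    (hV : ∀ i, IsOpen (V i)) (hirr : ∀ i, IsIrreducible (V i)) (hcov : ∀ x, ∃ i, x ∈ V i)
    (hmeet : ∀ i j, (V i ∩ V j).Nonempty) : IrreducibleSpace T := by
  refine (irreducibleSpace_def T).mpr ⟨?_, ?_⟩
  · obtain ⟨x, -⟩ := (hirr (Classical.arbitrary ι)).nonempty
    exact ⟨x, trivial⟩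
  · rintro U W hU hW ⟨x, -, hx⟩ ⟨y, -, hy⟩
    obtain ⟨i, hi⟩ := hcov x
    obtain ⟨j, hj⟩ := hcov y
    -- `U` is dense in `V i`, so that it meets `V i ∩ V j`.
    obtain ⟨z, hzi, hzj, hzU⟩ := (hirr i).isPreirreducible (V j) U (hV j) hU
      ((hmeet i j).imp fun z hz => ⟨hz.1, hz.2⟩) ⟨x, hi, hx⟩
    obtain ⟨w, -, hw⟩ := (hirr j).isPreirreducible U W hU hW ⟨z, hzj, hzU⟩ ⟨y, hj, hy⟩
    exact ⟨w, trivial, hw⟩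

/-- The condition on the intersections of the ranges makes them overlap after every base change to a
field, as a geometrically irreducible morphism has nonempty fibres. -/
theorem geometricallyIrreducible_of_cover {ι : Type*} [Nonempty ι] {X S : Scheme.{u}} (f : X ⟶ S)
    {U : ι → Scheme.{u}} (g : ∀ i, U i ⟶ X) [∀ i, IsOpenImmersion (g i)]
    (hcov : ∀ x : X, ∃ i, x ∈ Set.range (g i))
    (hmeet : ∀ i j, ∃ k, Set.range (g k) ⊆ Set.range (g i) ∩ Set.range (g j))
    [∀ i, GeometricallyIrreducible (g i ≫ f)] : GeometricallyIrreducible f := by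
  refine ⟨geometrically_iff_of_isClosedUnderIsomorphisms.mpr fun K _ y => ?_⟩
  let h (i : ι) : pullback (g i ≫ f) y ⟶ pullback f y :=
    pullback.map _ _ _ _ (g i) (𝟙 _) (𝟙 _) (by simp) (by simp)
  have hh (i : ι) : Set.range (h i) = pullback.fst f y ⁻¹' Set.range (g i) := by
    simp [h, Scheme.Pullback.range_map]
  have hirr (i : ι) : IrreducibleSpace ↥(pullback (g i ≫ f) y) :=
    GeometricallyIrreducible.geometrically_irreducibleSpace _ _ _ (.of_hasPullback _ _)
  refine irreducibleSpace_of_cover (fun i => Set.range (h i)) (fun i => ?_) (fun i => ?_)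
    (fun x => ?_) fun i j => ?_
  · rw [hh]
    exact (g i).opensRange.isOpen.preimage (pullback.fst f y).continuous
  · rw [← Set.image_univ]
    exact (IrreducibleSpace.isIrreducible_univ _).image _ (h i).continuous.continuousOn
  · simpa only [hh] using! hcov (pullback.fst f y x)
  · obtain ⟨k, hk⟩ := hmeet i j
    refine (Set.range_nonempty (h k)).mono ?_
    rw [hh, hh, hh, ← Set.preimage_inter]
    exact Set.preimage_mono hk

/-! ### The structural morphism of the inductive limit -/

/-- If the morphisms into a colimit are open immersions then they are jointly surjective: the
identity of the colimit factors through the union of their ranges. -/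
theorem exists_mem_range_colimit_ι {J : Type*} [Category* J] (F : J ⥤ Scheme.{u}) [HasColimit F]
    [∀ j, IsOpenImmersion (colimit.ι F j)] (x : (colimit F : Scheme.{u})) :
    ∃ j, x ∈ Set.range (colimit.ι F j) := by
  let U : (colimit F : Scheme.{u}).Opens := ⨆ j, (colimit.ι F j).opensRange
  have hU (j : J) : Set.range (colimit.ι F j) ⊆ Set.range U.ι := by
    rw [Scheme.Opens.range_ι]
    exact le_iSup (fun j => (colimit.ι F j).opensRange) j
  let s : Cocone F :=
    { pt := U
      ι :=
        { app j := IsOpenImmersion.lift U.ι (colimit.ι F j) (hU j)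
          naturality i j f := by simp [← cancel_mono U.ι] } }
  have hs : colimit.desc F s ≫ U.ι = 𝟙 _ := by
    ext j
    simp [s]
  have hx : U.ι (colimit.desc F s x) = x := by
    rw [← Scheme.Hom.comp_apply, hs]
    rfl
  have : x ∈ U := by
    rw [← hx]
    exact (colimit.desc F s x).2
  simpa [U] using! this

section System

variable {I : Type u} [SemilatticeInf I] [Nonempty I] (𝕄 : Iᵒᵖ ⥤ AddCommMonCat.{u})
  [OpenlyImmersive 𝕄] [∀ i, IsCancelAdd (𝕄.obj i)] [∀ i, IsAddTorsionFree (𝕄.obj i)]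

instance universallyOpen_ι_comp_terminal_from (i : I) :
    UniversallyOpen (colimit.ι (specIntDiagram 𝕄) i ≫ terminal.from (XInt 𝕄)) := by
  have := uniqueSums (M := 𝕄.obj (Opposite.op i))
  have := isIso_of_isTerminal specULiftZIsTerminal.{u} terminalIsTerminal (terminal.from _)
  rw [Subsingleton.elim (colimit.ι (specIntDiagram 𝕄) i ≫ terminal.from (XInt 𝕄))
    (specAlgebraMap (ULift.{u} ℤ) (𝕄.obj (Opposite.op i)) ≫ terminal.from _)]
  exact MorphismProperty.RespectsIso.postcomp @UniversallyOpen
    (terminal.from (Spec (CommRingCat.of (ULift.{u} ℤ))))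
    (specAlgebraMap (ULift.{u} ℤ) (𝕄.obj (Opposite.op i))) inferInstance

instance geometricallyIrreducible_ι_comp_terminal_from (i : I) :
    GeometricallyIrreducible (colimit.ι (specIntDiagram 𝕄) i ≫ terminal.from (XInt 𝕄)) := by
  have := uniqueSums (M := 𝕄.obj (Opposite.op i))
  have := isIso_of_isTerminal specULiftZIsTerminal.{u} terminalIsTerminal (terminal.from _)
  rw [Subsingleton.elim (colimit.ι (specIntDiagram 𝕄) i ≫ terminal.from (XInt 𝕄))
    (specAlgebraMap (ULift.{u} ℤ) (𝕄.obj (Opposite.op i)) ≫ terminal.from _)]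
  have : MorphismProperty.RespectsIso @GeometricallyIrreducible.{u} :=
    MorphismProperty.IsStableUnderBaseChange.respectsIso
  exact MorphismProperty.RespectsIso.postcomp @GeometricallyIrreducible
    (terminal.from (Spec (CommRingCat.of (ULift.{u} ℤ))))
    (specAlgebraMap (ULift.{u} ℤ) (𝕄.obj (Opposite.op i))) inferInstance

instance universallyOpen_terminal_from : UniversallyOpen (terminal.from (XInt 𝕄)) := by
  let 𝒰 : (XInt 𝕄).OpenCover := .mkOfCovers I _ (colimit.ι (specIntDiagram 𝕄))
    (exists_mem_range_colimit_ι _)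
  exact (IsZariskiLocalAtSource.iff_of_openCover (P := @UniversallyOpen) 𝒰).mpr fun i =>
    universallyOpen_ι_comp_terminal_from 𝕄 i

instance geometricallyIrreducible_terminal_from :
    GeometricallyIrreducible (terminal.from (XInt 𝕄)) := by
  refine geometricallyIrreducible_of_cover _ (colimit.ι (specIntDiagram 𝕄))
    (exists_mem_range_colimit_ι _) fun i j => ⟨i ⊓ j, Set.subset_inter ?_ ?_⟩
  · rw [← colimit.w (specIntDiagram 𝕄) (homOfLE (inf_le_left : i ⊓ j ≤ i))]
    rintro _ ⟨x, rfl⟩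
    exact ⟨_, (Scheme.Hom.comp_apply _ _ x).symm⟩
  · rw [← colimit.w (specIntDiagram 𝕄) (homOfLE (inf_le_right : i ⊓ j ≤ j))]
    rintro _ ⟨x, rfl⟩
    exact ⟨_, (Scheme.Hom.comp_apply _ _ x).symm⟩

theorem isConnected_preimage_t (S : Scheme.{u}) (s : S) : _root_.IsConnected (t 𝕄 S ⁻¹' {s}) :=
  ((t 𝕄 S).isIrreducible_preimage (t 𝕄 S).isOpenMap isIrreducible_singleton).isConnected

theorem isCoinducing_t (S : Scheme.{u}) : Topology.IsCoinducing (t 𝕄 S) :=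
  ((t 𝕄 S).isOpenMap.isQuotientMap (t 𝕄 S).continuous (t 𝕄 S).surjective).isCoinducing

end System

/-- The morphism `X_𝕄(Z) ⟶ X_𝕄(S)` is a base change of the immersion of `Z` along `t`, so that its
image is the preimage of `Z`. -/
theorem XSet_eq_preimage {I : Type u} [SemilatticeInf I] (𝕄 : Iᵒᵖ ⥤ AddCommMonCat.{u})
    [HasColimit (specIntDiagram 𝕄)] {S : Scheme.{u}} {Z : Set S} (hZ : IsClosed Z) :
    XSet 𝕄 Z = t 𝕄 S ⁻¹' Z := by
  simp [XSet, XMap, Scheme.Pullback.range_map, closedImmersion,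
    Scheme.IdealSheafData.range_subschemeι]

/-! ### Inverse bijections between sets of subsets -/

/-- If preimages and images under `f` exchange two collections of subsets, the second of which
consists of saturated sets, then they are inverse bijections. The map `Φ` only has to agree with the
preimage on the first collection. -/
theorem bijOn_of_preimage_image {X Y : Type*} {f : X → Y} (hf : Function.Surjective f)
    {A : Set (Set Y)} {B : Set (Set X)} {Φ : Set Y → Set X} (hΦ : ∀ Z ∈ A, Φ Z = f ⁻¹' Z)
    (hpre : ∀ Z ∈ A, f ⁻¹' Z ∈ B) (him : ∀ W ∈ B, f '' W ∈ A)
    (hsat : ∀ W ∈ B, f ⁻¹' (f '' W) = W) :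
    Set.BijOn (fun Z => Φ Z) A B ∧ Set.BijOn (fun W => f '' W) B A ∧
      Set.InvOn (fun W => f '' W) (fun Z => Φ Z) A B := by
  have hinv : Set.InvOn (fun W => f '' W) (fun Z => Φ Z) A B :=
    ⟨fun Z hZ => by simp [hΦ Z hZ, Set.image_preimage_eq Z hf],
      fun W hW => by simp [hΦ _ (him W hW), hsat W hW]⟩
  have hΦm : Set.MapsTo (fun Z => Φ Z) A B := fun Z hZ => by
    simpa [hΦ Z hZ] using hpre Z hZ
  exact ⟨hinv.bijOn hΦm him, hinv.symm.bijOn him hΦm, hinv⟩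

end MonoidGluing

theorem corollaryn270 {I : Type u} [SemilatticeInf I] [Nonempty I]
    (𝕄 : Iᵒᵖ ⥤ AddCommMonCat.{u}) [MonoidGluing.OpenlyImmersive 𝕄]
    [∀ i, IsCancelAdd (𝕄.obj i)] [∀ i, IsAddTorsionFree (𝕄.obj i)] (S : Scheme.{u}) :
    (Set.BijOn (fun Z : Set S => MonoidGluing.XSet 𝕄 Z)
        (irreducibleComponents S) (irreducibleComponents (MonoidGluing.X 𝕄 S)) ∧
      Set.BijOn (fun Z : Set (MonoidGluing.X 𝕄 S) => MonoidGluing.t 𝕄 S '' Z)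
        (irreducibleComponents (MonoidGluing.X 𝕄 S)) (irreducibleComponents S) ∧
      Set.InvOn (fun Z : Set (MonoidGluing.X 𝕄 S) => MonoidGluing.t 𝕄 S '' Z)
        (fun Z : Set S => MonoidGluing.XSet 𝕄 Z)
        (irreducibleComponents S) (irreducibleComponents (MonoidGluing.X 𝕄 S))) ∧
    ((Finite I ∨ (∀ i, AddMonoid.FG (𝕄.obj i)) ∨ (IsAffine S ∧ ∃ i : I, IsBot i)) →
      Set.BijOn (fun Z : Set S => MonoidGluing.XSet 𝕄 Z)
        (MonoidGluing.connectedComponentSets S)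
        (MonoidGluing.connectedComponentSets (MonoidGluing.X 𝕄 S)) ∧
      Set.BijOn (fun Z : Set (MonoidGluing.X 𝕄 S) => MonoidGluing.t 𝕄 S '' Z)
        (MonoidGluing.connectedComponentSets (MonoidGluing.X 𝕄 S))
        (MonoidGluing.connectedComponentSets S) ∧
      Set.InvOn (fun Z : Set (MonoidGluing.X 𝕄 S) => MonoidGluing.t 𝕄 S '' Z)
        (fun Z : Set S => MonoidGluing.XSet 𝕄 Z)
        (MonoidGluing.connectedComponentSets S)
        (MonoidGluing.connectedComponentSets (MonoidGluing.X 𝕄 S))) := by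
  have hsurj : Function.Surjective (MonoidGluing.t 𝕄 S) := (MonoidGluing.t 𝕄 S).surjective
  -- `t` is a quotient map with connected fibres, hence compatible with connected components.
  have hfib := MonoidGluing.isConnected_preimage_t 𝕄 S
  have hco := MonoidGluing.isCoinducing_t 𝕄 S
  refine ⟨?_, fun _ => ?_⟩
  · let e := (MonoidGluing.t 𝕄 S).irreducibleComponentsEquiv (MonoidGluing.t 𝕄 S).isOpenMap
    exact MonoidGluing.bijOn_of_preimage_image hsurj
      (fun Z hZ => MonoidGluing.XSet_eq_preimage 𝕄 (isClosed_of_mem_irreducibleComponents Z hZ))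
      (fun Z hZ => (e.symm ⟨Z, hZ⟩).2) (fun W hW => (e ⟨W, hW⟩).2)
      (fun W hW => congrArg Subtype.val (e.symm_apply_apply ⟨W, hW⟩))
  · refine MonoidGluing.bijOn_of_preimage_image hsurj ?_ ?_ ?_ ?_
    · rintro _ ⟨s, rfl⟩
      exact MonoidGluing.XSet_eq_preimage 𝕄 isClosed_connectedComponent
    · rintro _ ⟨s, rfl⟩
      obtain ⟨x, rfl⟩ := hsurj s
      exact ⟨x, (hco.preimage_connectedComponent hfib x).symm⟩
    · rintro _ ⟨x, rfl⟩
      exact ⟨_, (hco.image_connectedComponent hfib x).symm⟩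
    · rintro _ ⟨x, rfl⟩
      rw [hco.image_connectedComponent hfib, hco.preimage_connectedComponent hfib]
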